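/- Let $0<\alpha<1$. For a real $d\times d$ matrix $M$ and $\beta>0$ let $E_{\alpha,\beta}(M)=\sum_{k=0}^\infty \frac{M^k}{\Gamma(\alpha k+\beta)}$ and $E_\alpha=E_{\alpha,1}$ be the Mittag-Leffler functions, and let $\|\cdot\|$ be any norm on $\mathbb{R}^{d\times d}$. Let $A\in\mathbb{R}^{d\times d}$ be a matrix whose (complex) spectrum satisfies $$\sigma(A)\subset\left\{\lambda\in\mathbb{C}\setminus\{0\} : |\arg(\lambda)|>\frac{\alpha\pi}{2}\right\},$$ where $\arg$ takes values in $(-\pi,\pi]$. Then the following statements hold: (i) $\lim_{t\to\infty}\|E_\alpha(t^\alpha A)\|=0$; (ii) $\int_0^\infty \tau^{\alpha-1}\|E_{\alpha,\alpha}(\tau^\alpha A)\|\,d\tau<\infty$. -/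

import Mathlib

open Filter Topology MeasureTheory

noncomputable section

/-- The two-parameter Mittag-Leffler function of a real square matrix,
`E_{α,β}(M) = ∑_{k ≥ 0} M ^ k / Γ(α k + β)`. -/
def mittagLeffler₂ {d : ℕ} (α β : ℝ) (M : Matrix (Fin d) (Fin d) ℝ) :
    Matrix (Fin d) (Fin d) ℝ :=
  ∑' k : ℕ, (Real.Gamma (α * k + β))⁻¹ • M ^ k

/-- The one-parameter Mittag-Leffler function `E_α = E_{α,1}` of a real square matrix. -/
def mittagLeffler {d : ℕ} (α : ℝ) (M : Matrix (Fin d) (Fin d) ℝ) :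
    Matrix (Fin d) (Fin d) ℝ :=
  mittagLeffler₂ α 1 M

theorem gamma_ge_rpow {R x : ℝ} (hR : 0 < R) (hx : 1 ≤ x) :
    Real.exp (-(R + 1)) * R ^ (x - 1) ≤ Real.Gamma x := by
  have hx0 : 0 < x := by linarith
  rw [Real.Gamma_eq_integral hx0]
  have hint := Real.GammaIntegral_convergent hx0
  have hsub : Set.Ioc R (R + 1) ⊆ Set.Ioi 0 := fun t ht => hR.trans ht.1
  calc Real.exp (-(R + 1)) * R ^ (x - 1)
      = ∫ _ in Set.Ioc R (R + 1), Real.exp (-(R + 1)) * R ^ (x - 1) := by simp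
    _ ≤ ∫ t in Set.Ioc R (R + 1), Real.exp (-t) * t ^ (x - 1) := by
        refine setIntegral_mono_on (integrableOn_const (by simp)) (hint.mono_set hsub) measurableSet_Ioc ?_
        intro t ht
        have h1 : R ≤ t := ht.1.le
        have h2 : t ≤ R + 1 := ht.2
        have h3 : 0 ≤ x - 1 := by linarith
        gcongr
    _ ≤ _ := by
        refine setIntegral_mono_set hint ?_ hsub.eventuallyLE
        filter_upwards [ae_restrict_mem measurableSet_Ioi] with t ht
        have : (0 : ℝ) < t := ht
        simp only [Pi.zero_apply]
        positivity

/-- The Mittag-Leffler series converges for every matrix. -/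
theorem summable_mittagLeffler₂ {d : ℕ} {α : ℝ} (hα : 0 < α) (β : ℝ)
    (M : Matrix (Fin d) (Fin d) ℝ) :
    Summable fun k : ℕ => (Real.Gamma (α * k + β))⁻¹ • M ^ k := by
  let : NormedRing (Matrix (Fin d) (Fin d) ℝ) := Matrix.linftyOpNormedRing
  let : NormedAlgebra ℝ (Matrix (Fin d) (Fin d) ℝ) := Matrix.linftyOpNormedAlgebra
  set r : ℝ := ‖M‖ + 1 with hr
  have hr0 : 0 < r := by positivity
  set R : ℝ := (2 * r) ^ (α⁻¹) with hRdef
  have hR : 0 < R := by positivity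
  have hRα : R ^ α = 2 * r := by
    rw [hRdef, ← Real.rpow_mul (by positivity), inv_mul_cancel₀ hα.ne', Real.rpow_one]
  set c : ℝ := Real.exp (-(R + 1)) * R ^ (β - 1) with hc
  have hc0 : 0 < c := by positivity
  refine Summable.of_norm_bounded_eventually_nat
    (g := fun k : ℕ => c⁻¹ * (1 / 2) ^ k) (summable_geometric_two.mul_left _) ?_
  have hev : ∀ᶠ k : ℕ in atTop, 1 ≤ α * k + β := by
    have : Tendsto (fun k : ℕ => α * (k : ℝ) + β) atTop atTop :=
      tendsto_atTop_add_const_right _ _ (tendsto_natCast_atTop_atTop.const_mul_atTop hα)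
    exact this.eventually_ge_atTop 1
  filter_upwards [hev, eventually_gt_atTop 0] with k hk hk0
  have hG : c * (2 * r) ^ k ≤ Real.Gamma (α * k + β) := by
    have h := gamma_ge_rpow hR hk
    have e : R ^ (α * k + β - 1) = (2 * r) ^ k * R ^ (β - 1) := by
      rw [add_sub_assoc, Real.rpow_add hR, Real.rpow_mul hR.le, hRα, Real.rpow_natCast]
    rw [e] at h
    calc c * (2 * r) ^ k = Real.exp (-(R + 1)) * ((2 * r) ^ k * R ^ (β - 1)) := by
          rw [hc]; ring
      _ ≤ _ := h
  have hpos : 0 < c * (2 * r) ^ k := by positivity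
  have hM : ‖M ^ k‖ ≤ r ^ k :=
    (norm_pow_le' M hk0).trans (pow_le_pow_left₀ (norm_nonneg _) (by linarith) k)
  calc ‖(Real.Gamma (α * k + β))⁻¹ • M ^ k‖
      = (Real.Gamma (α * k + β))⁻¹ * ‖M ^ k‖ := by
        rw [norm_smul, Real.norm_of_nonneg (inv_nonneg.2 (hpos.le.trans hG))]
    _ ≤ (c * (2 * r) ^ k)⁻¹ * r ^ k := by
        gcongr
    _ = c⁻¹ * (1 / 2) ^ k := by
        rw [mul_pow, one_div, inv_pow]
        field_simp

end

/-! Both claims follow from decay rates obtained from a contour integral. Hankel's formula `1/Γ(b) =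
(2πi)⁻¹ ∫ exp(s) s^(-b) ds`, summed against `M ^ k`, gives `E_{α,β}(M) = (2πi)⁻¹ ∫ exp(s) s^(α-β)
(s^α - M)⁻¹ ds` on a contour far enough out for the Neumann series to converge
(`hankelIntegral_resolvent`). The substitution `s = exp w` avoids branch cuts and turns the contour
into the boundary of a half-strip.

The spectral condition leaves room for rays at an angle slightly above `π/2` such that `s^α` stays
in a closed sector free of spectrum, where the resolvent of `A` is bounded
(`exists_sector_resolvent_bound`). For `M = t^α A` the contour can then be pulled back to a fixed
one. Homogeneity of the resolvent contributes `t^(-α)`, so `E_{α,β}(t^α A) = O(t^(-α))` for every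
real `β` (`exists_norm_mittagLeffler_le`). The case `β = 1` gives (i).

For (ii) this rate only bounds the integrand by `τ^(-1)`. Since `1/Γ(0) = 0`, `E_{α,0}(M) = M
E_{α,α}(M)`; as `A` is invertible, the rate for `β = 0` improves to `O(t^(-2α))` for `β = α`, and
the integrand is `O(τ^(-1-α))` at infinity. Near zero it is bounded by a multiple of `τ^(α-1)`. -/

noncomputable section

/-! ### Contour deformation by Cauchy's theorem -/

section Contour

variable {E : Type*} [NormedAddCommGroup E] [NormedSpace ℂ E]

/-- The integral of `f` along the boundary of the half-strip `{w | x ≤ re w, |im w| ≤ φ}`. In the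
variable `exp w` this is a Hankel contour, with rays at the angles `±φ` and an arc of radius
`exp x`. -/
def hankelIntegral (φ x : ℝ) (f : ℂ → E) : E :=
  (∫ u in Set.Ioi x, f (u + φ * Complex.I)) - (∫ u in Set.Ioi x, f (u + (-φ : ℝ) * Complex.I)) +
    Complex.I • ∫ θ in (-φ)..φ, f (x + θ * Complex.I)

theorem rectangle_integral_eq_zero [CompleteSpace E] {f : ℂ → E} {x y η ζ : ℝ} (hηζ : η ≤ ζ)
    (hf : ∀ w : ℂ, η ≤ w.im → w.im ≤ ζ → DifferentiableAt ℂ f w) :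
    (∫ u in x..y, f (u + η * Complex.I)) - (∫ u in x..y, f (u + ζ * Complex.I)) +
      Complex.I • (∫ θ in η..ζ, f (y + θ * Complex.I)) -
      Complex.I • (∫ θ in η..ζ, f (x + θ * Complex.I)) = 0 := by
  have h := Complex.integral_boundary_rect_eq_zero_of_differentiableOn f ⟨x, η⟩ ⟨y, ζ⟩ (by
    intro w hw
    have := hw.2
    simp only [Set.mem_preimage, Set.uIcc_of_le hηζ] at this
    exact (hf w this.1 this.2).differentiableWithinAt)
  simpa using h

/-- The two contours differ by the boundary of a rectangle. Holomorphy is needed only on the strip,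
so this also applies to integrands containing a resolvent. -/
theorem hankelIntegral_eq_of_differentiable [CompleteSpace E] {f : ℂ → E} {φ : ℝ} (hφ : 0 ≤ φ)
    (hf : ∀ w : ℂ, |w.im| ≤ φ → DifferentiableAt ℂ f w) {x y : ℝ}
    (h1 : ∀ x : ℝ, IntegrableOn (fun u : ℝ => f (u + φ * Complex.I)) (Set.Ioi x))
    (h2 : ∀ x : ℝ, IntegrableOn (fun u : ℝ => f (u + (-φ : ℝ) * Complex.I)) (Set.Ioi x)) :
    hankelIntegral φ x f = hankelIntegral φ y f := by
  have h := rectangle_integral_eq_zero (f := f) (x := x) (y := y) (η := -φ) (ζ := φ)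
    (by linarith) (fun w h1 h2 => hf w (abs_le.2 ⟨h1, h2⟩))
  rw [← intervalIntegral.integral_Ioi_sub_Ioi' (h1 x) (h1 y),
    ← intervalIntegral.integral_Ioi_sub_Ioi' (h2 x) (h2 y)] at h
  rw [← sub_eq_zero, ← neg_eq_zero, ← h]
  unfold hankelIntegral
  abel

/-- Cauchy's theorem on a rectangle whose right side goes to infinity, where the bound `B` makes
that side vanish. -/
theorem integral_ray_eq [CompleteSpace E] {f : ℂ → E} {x η ζ : ℝ} (hηζ : η ≤ ζ)
    (hf : ∀ w : ℂ, η ≤ w.im → w.im ≤ ζ → DifferentiableAt ℂ f w)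
    (h1 : IntegrableOn (fun u : ℝ => f (u + η * Complex.I)) (Set.Ioi x))
    (h2 : IntegrableOn (fun u : ℝ => f (u + ζ * Complex.I)) (Set.Ioi x))
    {B : ℝ → ℝ} (hB : Tendsto B atTop (𝓝 0))
    (hfB : ∀ u θ : ℝ, η ≤ θ → θ ≤ ζ → ‖f (u + θ * Complex.I)‖ ≤ B u) :
    (∫ u in Set.Ioi x, f (u + η * Complex.I)) - (∫ u in Set.Ioi x, f (u + ζ * Complex.I)) =
      Complex.I • ∫ θ in η..ζ, f (x + θ * Complex.I) := by
  have hv : Tendsto (fun y : ℝ => Complex.I • ∫ θ in η..ζ, f (y + θ * Complex.I)) atTop (𝓝 0) := by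
    rw [tendsto_zero_iff_norm_tendsto_zero]
    refine squeeze_zero (fun _ => norm_nonneg _) (g := fun y => B y * |ζ - η|) (fun y => ?_)
      (by simpa using hB.mul_const _)
    rw [norm_smul, Complex.norm_I, one_mul]
    refine intervalIntegral.norm_integral_le_of_norm_le_const fun θ hθ => ?_
    rw [Set.uIoc_of_le hηζ] at hθ
    exact hfB y θ hθ.1.le hθ.2
  have h := ((((intervalIntegral_tendsto_integral_Ioi x h1 tendsto_id).sub
    (intervalIntegral_tendsto_integral_Ioi x h2 tendsto_id)).add hv).sub
    (tendsto_const_nhds (x := Complex.I • ∫ θ in η..ζ, f (x + θ * Complex.I))))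
  have h0 := tendsto_nhds_unique h (tendsto_const_nhds.congr fun y =>
    (rectangle_integral_eq_zero hηζ hf).symm)
  rwa [add_zero, sub_eq_zero] at h0

theorem hankelIntegral_add_angle [CompleteSpace E] {f : ℂ → E} {x φ ψ : ℝ} (hφ : 0 ≤ φ)
    (hφψ : φ ≤ ψ) (hf : Differentiable ℂ f)
    (h1 : ∀ θ : ℝ, φ ≤ |θ| → |θ| ≤ ψ →
      IntegrableOn (fun u : ℝ => f (u + θ * Complex.I)) (Set.Ioi x))
    {B : ℝ → ℝ} (hB : Tendsto B atTop (𝓝 0))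
    (hfB : ∀ u θ : ℝ, φ ≤ |θ| → |θ| ≤ ψ → ‖f (u + θ * Complex.I)‖ ≤ B u) :
    hankelIntegral φ x f = hankelIntegral ψ x f := by
  have hψ : 0 ≤ ψ := hφ.trans hφψ
  have a1 : |φ| = φ := abs_of_nonneg hφ
  have a2 : |ψ| = ψ := abs_of_nonneg hψ
  have e1 := integral_ray_eq (x := x) hφψ (fun w _ _ => hf w) (h1 φ a1.ge (a1.trans_le hφψ))
    (h1 ψ (a2.symm ▸ hφψ) a2.le) hB
    fun u θ h h' => hfB u θ (by rwa [abs_of_nonneg (hφ.trans h)])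
      (by rwa [abs_of_nonneg (hφ.trans h)])
  have e2 := integral_ray_eq (x := x) (neg_le_neg hφψ) (fun w _ _ => hf w)
    (h1 (-ψ) (by rwa [abs_neg, a2]) (by rw [abs_neg, a2]))
    (h1 (-φ) (by rw [abs_neg, a1]) (by rwa [abs_neg, a1])) hB
    fun u θ h h' => hfB u θ (by rw [abs_of_nonpos (by linarith)]; linarith)
      (by rw [abs_of_nonpos (by linarith)]; linarith)
  have hc : Continuous fun θ : ℝ => f (x + θ * Complex.I) :=
    hf.continuous.comp (by fun_prop)
  have e3 := intervalIntegral.integral_add_adjacent_intervals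
    (hc.intervalIntegrable (μ := volume) (-ψ) (-φ)) (hc.intervalIntegrable (-φ) φ)
  have e4 := intervalIntegral.integral_add_adjacent_intervals
    (hc.intervalIntegrable (μ := volume) (-ψ) φ) (hc.intervalIntegrable φ ψ)
  unfold hankelIntegral
  rw [← e4, ← e3, smul_add, smul_add, ← e1, ← e2]
  abel

end Contour

/-! ### Hankel's formula for the reciprocal Gamma function -/

/-- The integrand `exp (exp w) * exp (κ w)` of the Hankel integrals, in logarithmic coordinates. -/
def hankelKernel (κ : ℝ) (w : ℂ) : ℂ := Complex.exp (Complex.exp w + κ * w)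

theorem differentiable_hankelKernel (κ : ℝ) : Differentiable ℂ (hankelKernel κ) := by
  unfold hankelKernel
  fun_prop

theorem continuous_hankelKernel (κ : ℝ) : Continuous (hankelKernel κ) :=
  (differentiable_hankelKernel κ).continuous

theorem norm_hankelKernel (κ u θ : ℝ) :
    ‖hankelKernel κ (u + θ * Complex.I)‖ = Real.exp (Real.exp u * Real.cos θ + κ * u) := by
  rw [hankelKernel, Complex.norm_exp]
  simp [Complex.exp_re]

/-- With `r = exp u` this is the decay of `r ^ κ * exp (-c r)`. -/
theorem tendsto_exp_neg_exp_add {c : ℝ} (hc : 0 < c) (κ : ℝ) :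
    Tendsto (fun u : ℝ => Real.exp (-c * Real.exp u + κ * u)) atTop (𝓝 0) := by
  refine ((tendsto_rpow_mul_exp_neg_mul_atTop_nhds_zero κ c hc).comp
    Real.tendsto_exp_atTop).congr fun u => ?_
  simp only [Function.comp]
  rw [← Real.exp_mul, ← Real.exp_add]
  ring_nf

theorem integrableOn_exp_neg_exp_add {c : ℝ} (hc : 0 < c) (κ x : ℝ) :
    IntegrableOn (fun u : ℝ => Real.exp (-c * Real.exp u + κ * u)) (Set.Ioi x) := by
  refine integrable_of_isBigO_exp_neg one_pos (by fun_prop) ?_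
  refine Asymptotics.IsLittleO.isBigO ?_
  rw [Asymptotics.isLittleO_iff_tendsto fun u hu => absurd hu (Real.exp_ne_zero _)]
  refine (tendsto_exp_neg_exp_add hc (κ + 1)).congr fun u => ?_
  rw [← Real.exp_sub]
  ring_nf

theorem norm_hankelKernel_le {κ u θ c : ℝ} (hθ : Real.cos θ ≤ -c) :
    ‖hankelKernel κ (u + θ * Complex.I)‖ ≤ Real.exp (-c * Real.exp u + κ * u) := by
  rw [norm_hankelKernel]
  have := mul_le_mul_of_nonneg_left hθ (Real.exp_pos u).le
  exact Real.exp_le_exp.2 (by linarith)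

theorem integrableOn_hankelKernel {κ θ : ℝ} (hθ : Real.cos θ < 0) (x : ℝ) :
    IntegrableOn (fun u : ℝ => hankelKernel κ (u + θ * Complex.I)) (Set.Ioi x) := by
  refine Integrable.mono' (integrableOn_exp_neg_exp_add (neg_pos.2 hθ) κ x)
    ((continuous_hankelKernel κ).comp (by fun_prop)).aestronglyMeasurable
    (ae_of_all _ fun u => norm_hankelKernel_le (neg_neg _).ge)

/-- The cosine stays at most `cos φ < 0` for angles between `φ` and `π`, so the kernel decays
uniformly while the rays are rotated onto the negative axis. -/
theorem hankelIntegral_hankelKernel_pi {φ : ℝ} (h1 : Real.pi / 2 < φ) (h2 : φ ≤ Real.pi)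
    (κ x : ℝ) :
    hankelIntegral φ x (hankelKernel κ) = hankelIntegral Real.pi x (hankelKernel κ) := by
  have hpi := Real.pi_pos
  have hc : ∀ θ : ℝ, φ ≤ |θ| → |θ| ≤ Real.pi → Real.cos θ ≤ -(-Real.cos φ) := fun θ h h' => by
    rw [neg_neg, ← Real.cos_abs θ]
    exact Real.cos_le_cos_of_nonneg_of_le_pi (by linarith) h' h
  have hφ : Real.cos φ < 0 := Real.cos_neg_of_pi_div_two_lt_of_lt h1 (by linarith)
  exact hankelIntegral_add_angle (by linarith) h2 (differentiable_hankelKernel κ)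
    (fun θ h h' => integrableOn_hankelKernel (by linarith [hc θ h h']) x)
    (tendsto_exp_neg_exp_add (neg_pos.2 hφ) κ)
    (fun u θ h h' => norm_hankelKernel_le (hc θ h h'))

theorem hankelIntegral_hankelKernel_eq (κ x y : ℝ) :
    hankelIntegral Real.pi x (hankelKernel κ) = hankelIntegral Real.pi y (hankelKernel κ) :=
  hankelIntegral_eq_of_differentiable Real.pi_pos.le
    (fun w _ => differentiable_hankelKernel κ w)
    (fun x => integrableOn_hankelKernel (by simp) x)
    (fun x => integrableOn_hankelKernel (by simp) x)

theorem hankelKernel_add_pi_mul_I (κ u : ℝ) {s : ℝ} (hs : Complex.exp (s * Complex.I) = -1) :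
    hankelKernel κ (u + s * Complex.I) =
      Complex.exp (κ * s * Complex.I) * (Real.exp (-Real.exp u + κ * u) : ℝ) := by
  rw [hankelKernel, Complex.exp_add (u : ℂ), hs, Complex.ofReal_exp, ← Complex.exp_add]
  push_cast
  ring_nf

/-- At height `±π` the factor `exp w` is the negative real `-exp u`, so the two rays carry the same
real integral with phases `exp (±iπκ)`, whose difference is `2i sin (πκ)`. -/
theorem hankelIntegral_pi_hankelKernel (κ x : ℝ) :
    hankelIntegral Real.pi x (hankelKernel κ) =
      2 * Complex.I * ((Real.sin (Real.pi * κ) *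
        ∫ u in Set.Ioi x, Real.exp (-Real.exp u + κ * u) : ℝ) : ℂ) +
      Complex.I * ∫ θ in (-Real.pi)..Real.pi, hankelKernel κ (x + θ * Complex.I) := by
  unfold hankelIntegral
  have h1 : ∀ u : ℝ, hankelKernel κ (u + Real.pi * Complex.I) = _ := fun u =>
    hankelKernel_add_pi_mul_I κ u Complex.exp_pi_mul_I
  have h2 : ∀ u : ℝ, hankelKernel κ (u + (-Real.pi : ℝ) * Complex.I) = _ := fun u =>
    hankelKernel_add_pi_mul_I κ u (by simp [Complex.exp_neg])
  simp_rw [h1, h2, integral_const_mul, smul_eq_mul]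
  rw [← sub_mul, integral_complex_ofReal]
  congr 1
  push_cast
  rw [← mul_assoc]
  congr 1
  have e1 : (κ * Real.pi * Complex.I : ℂ) = (Real.pi * κ : ℂ) * Complex.I := by ring
  have e2 : (κ * -Real.pi * Complex.I : ℂ) = -(Real.pi * κ : ℂ) * Complex.I := by ring
  rw [e1, e2, Complex.exp_mul_I, Complex.exp_mul_I, Complex.cos_neg, Complex.sin_neg]
  ring

theorem tendsto_integral_exp_neg_exp_add {a : ℝ} (ha : 0 < a) :
    Tendsto (fun x : ℝ => ∫ u in Set.Ioi x, Real.exp (-Real.exp u + a * u)) atBot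
      (𝓝 (Real.Gamma a)) := by
  have key : ∀ x : ℝ, ∫ u in Set.Ioi x, Real.exp (-Real.exp u + a * u) =
      ∫ r in Set.Ioi (Real.exp x), Real.exp (-r) * r ^ (a - 1) := fun x => by
    rw [← integral_comp_exp_Ioi]
    refine integral_congr_ae (ae_of_all _ fun u => ?_)
    simp only [smul_eq_mul]
    rw [← Real.exp_mul, ← Real.exp_add, ← Real.exp_add]
    ring_nf
  simp_rw [key]
  rw [Real.Gamma_eq_integral ha]
  have hcov := (aecover_Ioi_of_Ioi (μ := (volume : Measure ℝ)) (A := 0)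
    (Real.tendsto_exp_atBot)).integral_tendsto_of_countably_generated
    (Real.GammaIntegral_convergent ha)
  refine hcov.congr fun x => ?_
  rw [Measure.restrict_restrict measurableSet_Ioi, Set.inter_eq_left.2]
  exact Set.Ioi_subset_Ioi (Real.exp_pos x).le

theorem norm_hankelKernel_le_of_nonpos {κ u θ : ℝ} (hu : u ≤ 0) :
    ‖hankelKernel κ (u + θ * Complex.I)‖ ≤ Real.exp (1 + κ * u) := by
  rw [norm_hankelKernel]
  have h1 : Real.exp u ≤ 1 := Real.exp_le_one_iff.2 hu
  have : Real.exp u * Real.cos θ ≤ 1 := by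
    nlinarith [Real.exp_pos u, Real.cos_le_one θ]
  gcongr

/-- Hankel's formula for `1 / Γ(b)`, for `b < 1`. -/
theorem hankelIntegral_pi_eq_of_lt {b : ℝ} (hb : b < 1) (x : ℝ) :
    hankelIntegral Real.pi x (hankelKernel (1 - b)) =
      2 * Real.pi * Complex.I * ((Real.Gamma b)⁻¹ : ℝ) := by
  have ha : 0 < 1 - b := by linarith
  have hv : Tendsto (fun x : ℝ => Complex.I *
      ∫ θ in (-Real.pi)..Real.pi, hankelKernel (1 - b) (x + θ * Complex.I)) atBot (𝓝 0) := by
    rw [tendsto_zero_iff_norm_tendsto_zero]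
    have ht : Tendsto (fun x : ℝ => Real.exp (1 + (1 - b) * x) * |Real.pi - -Real.pi|)
        atBot (𝓝 0) := by
      have : Tendsto (fun x : ℝ => 1 + (1 - b) * x) atBot atBot :=
        tendsto_atBot_add_const_left _ _ (tendsto_id.const_mul_atBot ha)
      simpa using (Real.tendsto_exp_atBot.comp this).mul_const _
    refine squeeze_zero' (Eventually.of_forall fun _ => norm_nonneg _) ?_ ht
    filter_upwards [eventually_le_atBot 0] with x hx
    rw [norm_mul, Complex.norm_I, one_mul]
    exact intervalIntegral.norm_integral_le_of_norm_le_const fun θ _ =>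
      norm_hankelKernel_le_of_nonpos hx
  have hl := ((((Complex.continuous_ofReal.tendsto _).comp
    ((tendsto_integral_exp_neg_exp_add ha).const_mul (Real.sin (Real.pi * (1 - b))))).const_mul
    (2 * Complex.I)).add hv)
  -- The integral does not depend on `x`, so it equals its limit as `x → -∞`: the arc vanishes and
  -- the rays give `Γ(1 - b)`.
  have h := tendsto_nhds_unique (tendsto_const_nhds.congr fun y =>
    (hankelIntegral_hankelKernel_eq (1 - b) x y).trans (hankelIntegral_pi_hankelKernel _ y)) hl
  rw [h, add_zero]
  have hG := Real.Gamma_mul_Gamma_one_sub (1 - b)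
  rw [sub_sub_cancel] at hG
  have hGa : Real.Gamma (1 - b) ≠ 0 := (Real.Gamma_pos_of_pos ha).ne'
  have hpi := Real.pi_ne_zero
  -- Euler's reflection formula. At the poles of `Γ(b)` both sides are `0`, under the conventions
  -- that `Γ` is `0` there and `0⁻¹ = 0`.
  have : Real.sin (Real.pi * (1 - b)) * Real.Gamma (1 - b) = Real.pi * (Real.Gamma b)⁻¹ := by
    have h3 : Real.Gamma b = Real.pi / Real.sin (Real.pi * (1 - b)) / Real.Gamma (1 - b) := by
      rw [← hG]; field_simp
    rw [h3, inv_div, div_div_eq_mul_div]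
    field_simp
  rw [this]
  push_cast
  ring

/-- The case `b = 1`: the rays cancel because `sin 0 = 0`, and on the arc the kernel tends to `1` as
`x → -∞`. It needs its own argument, since the recurrence in `b` degenerates here. -/
theorem hankelIntegral_pi_eq_one (x : ℝ) :
    hankelIntegral Real.pi x (hankelKernel 0) = 2 * Real.pi * Complex.I := by
  have hv : Tendsto (fun x : ℝ => Complex.I *
      ∫ θ in (-Real.pi)..Real.pi, hankelKernel 0 (x + θ * Complex.I)) atBot
      (𝓝 (Complex.I * ∫ _ in (-Real.pi)..Real.pi, (1 : ℂ))) := by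
    refine Tendsto.const_mul _ ?_
    refine intervalIntegral.tendsto_integral_filter_of_dominated_convergence (fun _ => Real.exp 1)
      (Eventually.of_forall fun y => ((continuous_hankelKernel 0).comp
        (by fun_prop)).aestronglyMeasurable) ?_ (by simp) ?_
    · filter_upwards [eventually_le_atBot 0] with y hy
      refine ae_of_all _ fun θ _ => ?_
      simpa using norm_hankelKernel_le_of_nonpos (κ := 0) (θ := θ) hy
    · refine ae_of_all _ fun θ _ => ?_
      have h : Tendsto (fun y : ℝ => Complex.exp ((Real.exp y : ℝ) * Complex.exp (θ * Complex.I)))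
          atBot (𝓝 (Complex.exp ((0 : ℝ) * Complex.exp (θ * Complex.I)))) :=
        (Complex.continuous_exp.tendsto _).comp
          (((Complex.continuous_ofReal.tendsto _).comp Real.tendsto_exp_atBot).mul_const _)
      simp only [Complex.ofReal_zero, zero_mul, Complex.exp_zero] at h
      refine h.congr fun y => ?_
      simp [hankelKernel, Complex.exp_add]
  have h := tendsto_nhds_unique (tendsto_const_nhds.congr fun y =>
    (hankelIntegral_hankelKernel_eq 0 x y).trans
      ((hankelIntegral_pi_hankelKernel 0 y).trans (by simp))) hv
  rw [h]
  simp
  ring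

theorem hasDerivAt_hankelKernel (κ : ℝ) (w : ℂ) :
    HasDerivAt (hankelKernel κ) (hankelKernel (κ + 1) w + κ * hankelKernel κ w) w := by
  have h := ((Complex.hasDerivAt_exp w).add ((hasDerivAt_id w).const_mul (κ : ℂ))).cexp
  refine h.congr_deriv ?_
  have : hankelKernel (κ + 1) w = hankelKernel κ w * Complex.exp w := by
    simp only [hankelKernel]
    rw [← Complex.exp_add]
    push_cast
    ring_nf
  rw [this]
  simp [hankelKernel]
  ring

/-- The contour counterpart of `Γ(b + 1) = b Γ(b)`: the derivative of the kernel integrates to zero,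
because the kernel vanishes at both ends of the contour. -/
theorem hankelIntegral_hankelKernel_add_one (κ x : ℝ) :
    hankelIntegral Real.pi x (hankelKernel (κ + 1)) =
      -κ * hankelIntegral Real.pi x (hankelKernel κ) := by
  have hray : ∀ s : ℝ, Real.cos s < 0 →
      (∫ u in Set.Ioi x, hankelKernel (κ + 1) (u + s * Complex.I)) +
        κ * (∫ u in Set.Ioi x, hankelKernel κ (u + s * Complex.I)) =
      - hankelKernel κ (x + s * Complex.I) := fun s hs => by
    rw [← integral_const_mul, ← integral_add (integrableOn_hankelKernel hs x)
      ((integrableOn_hankelKernel hs x).const_mul _)]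
    rw [integral_Ioi_of_hasDerivAt_of_tendsto' (m := 0)
      (f := fun u : ℝ => hankelKernel κ (u + s * Complex.I)), zero_sub]
    · intro u _
      have := (hasDerivAt_hankelKernel κ (u + s * Complex.I)).comp_add_const (u : ℂ) (s * Complex.I)
      exact this.comp_ofReal
    · exact (integrableOn_hankelKernel hs x).add ((integrableOn_hankelKernel hs x).const_mul _)
    · rw [tendsto_zero_iff_norm_tendsto_zero]
      exact squeeze_zero (fun _ => norm_nonneg _)
        (fun u => norm_hankelKernel_le (neg_neg (Real.cos s)).ge)
        (tendsto_exp_neg_exp_add (neg_pos.2 hs) κ)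
  have harc : Complex.I * (∫ θ in (-Real.pi)..Real.pi, hankelKernel (κ + 1) (x + θ * Complex.I)) +
      κ * (Complex.I * ∫ θ in (-Real.pi)..Real.pi, hankelKernel κ (x + θ * Complex.I)) =
      hankelKernel κ (x + Real.pi * Complex.I) -
        hankelKernel κ (x + (-Real.pi : ℝ) * Complex.I) := by
    have hc : ∀ κ : ℝ, Continuous fun θ : ℝ => hankelKernel κ (x + θ * Complex.I) := fun κ =>
      (continuous_hankelKernel κ).comp (by fun_prop)
    rw [mul_left_comm, ← mul_add, ← intervalIntegral.integral_const_mul,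
      ← intervalIntegral.integral_add ((hc _).intervalIntegrable _ _)
        (((hc _).const_mul _).intervalIntegrable _ _), ← intervalIntegral.integral_const_mul]
    rw [intervalIntegral.integral_eq_sub_of_hasDerivAt
      (f := fun θ : ℝ => hankelKernel κ (x + θ * Complex.I))]
    · intro θ _
      have h1 : HasDerivAt (fun z : ℂ => (x : ℂ) + z * Complex.I) Complex.I (θ : ℂ) := by
        simpa using ((hasDerivAt_id (θ : ℂ)).mul_const Complex.I).const_add (x : ℂ)
      have := ((hasDerivAt_hankelKernel κ (x + θ * Complex.I)).comp (θ : ℂ) h1).comp_ofReal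
      exact this.congr_deriv (mul_comm _ _)
    · exact (((hc _).add ((hc _).const_mul _)).const_mul _).intervalIntegrable _ _
  have h1 := hray Real.pi (by simp)
  have h2 := hray (-Real.pi) (by simp)
  unfold hankelIntegral
  simp only [smul_eq_mul]
  linear_combination h1 - h2 + harc

theorem hankelIntegral_pi_eq (b x : ℝ) :
    hankelIntegral Real.pi x (hankelKernel (1 - b)) =
      2 * Real.pi * Complex.I * ((Real.Gamma b)⁻¹ : ℝ) := by
  obtain ⟨n, hn⟩ := exists_nat_gt (b - 1)
  induction n generalizing b with
  | zero => exact hankelIntegral_pi_eq_of_lt (by simpa using hn) x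
  | succ n ih =>
    rcases lt_trichotomy b 1 with hb | rfl | hb
    · exact hankelIntegral_pi_eq_of_lt hb x
    · simpa using hankelIntegral_pi_eq_one x
    -- The recurrence passes from `b - 1` to `b`; the factor `b - 1` to be divided out is nonzero
    -- here.
    · have h := ih (b - 1) (by push_cast at hn; linarith)
      have hr := hankelIntegral_hankelKernel_add_one (1 - b) x
      rw [show 1 - b + 1 = 1 - (b - 1) by ring, h] at hr
      have hG : Real.Gamma b = (b - 1) * Real.Gamma (b - 1) := by
        simpa using Real.Gamma_add_one (s := b - 1) (by linarith)
      have hb' : ((b - 1 : ℝ) : ℂ) ≠ 0 := Complex.ofReal_ne_zero.2 (by linarith)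
      rw [hG, mul_inv]
      push_cast at hr hb' ⊢
      field_simp
      linear_combination -hr

/-- **Hankel's formula** for the reciprocal Gamma function. -/
theorem hankelIntegral_eq {φ : ℝ} (h1 : Real.pi / 2 < φ) (h2 : φ ≤ Real.pi) (b x : ℝ) :
    hankelIntegral φ x (hankelKernel (1 - b)) =
      2 * Real.pi * Complex.I * ((Real.Gamma b)⁻¹ : ℝ) :=
  (hankelIntegral_hankelKernel_pi h1 h2 _ x).trans (hankelIntegral_pi_eq b x)

/-! ### Bounds and termwise summation for Hankel integrals -/

section

variable {E : Type*} [NormedAddCommGroup E] [NormedSpace ℂ E]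

theorem integrableOn_ray_of_norm_le {E : Type*} [NormedAddCommGroup E] {f : ℂ → E} {θ D κ x : ℝ} (hθ : Real.cos θ < 0)
    (hf : Continuous fun u : ℝ => f (u + θ * Complex.I))
    (hfD : ∀ u : ℝ, x ≤ u → ‖f (u + θ * Complex.I)‖ ≤ D * ‖hankelKernel κ (u + θ * Complex.I)‖) :
    IntegrableOn (fun u : ℝ => f (u + θ * Complex.I)) (Set.Ioi x) := by
  refine Integrable.mono' ((integrableOn_hankelKernel (κ := κ) hθ x).norm.const_mul D)
    hf.aestronglyMeasurable ?_
  filter_upwards [ae_restrict_mem measurableSet_Ioi] with u hu using hfD u (le_of_lt hu)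

/-- `K` is the integral of the kernel's norm along the contour. It is independent of `f`, which
later makes the estimate uniform in `t`. -/
theorem exists_norm_hankelIntegral_le {φ : ℝ} (h1 : Real.pi / 2 < φ) (h2 : φ < Real.pi)
    (κ : ℝ) : ∃ K : ℝ, ∀ (f : ℂ → E) (D : ℝ),
      (∀ w : ℂ, |w.im| ≤ φ → ‖f w‖ ≤ D * ‖hankelKernel κ w‖) →
      ‖hankelIntegral φ 0 f‖ ≤ D * K := by
  have hpi := Real.pi_pos
  have hφ : Real.cos φ < 0 := Real.cos_neg_of_pi_div_two_lt_of_lt h1 (by linarith)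
  have hφ0 : |φ| = φ := abs_of_pos (by linarith)
  refine ⟨(∫ u in Set.Ioi (0 : ℝ), ‖hankelKernel κ (u + φ * Complex.I)‖) +
    (∫ u in Set.Ioi (0 : ℝ), ‖hankelKernel κ (u + (-φ : ℝ) * Complex.I)‖) +
    ∫ θ in (-φ)..φ, ‖hankelKernel κ ((0 : ℝ) + θ * Complex.I)‖, fun f D hf => ?_⟩
  have hray : ∀ s : ℝ, |s| = φ → ‖∫ u in Set.Ioi (0 : ℝ), f (u + s * Complex.I)‖ ≤
      D * ∫ u in Set.Ioi (0 : ℝ), ‖hankelKernel κ (u + s * Complex.I)‖ := fun s hs => by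
    rw [← integral_const_mul]
    refine norm_integral_le_of_norm_le ((integrableOn_hankelKernel ?_ 0).norm.const_mul D)
      (ae_of_all _ fun u => hf _ (by simp [hs]))
    rwa [← Real.cos_abs, hs]
  have harc : ‖∫ θ in (-φ)..φ, f ((0 : ℝ) + θ * Complex.I)‖ ≤
      D * ∫ θ in (-φ)..φ, ‖hankelKernel κ ((0 : ℝ) + θ * Complex.I)‖ := by
    rw [← intervalIntegral.integral_const_mul]
    refine intervalIntegral.norm_integral_le_of_norm_le (by linarith)
      (ae_of_all _ fun θ hθ => hf _ ?_) ?_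
    · simpa using abs_le.2 ⟨hθ.1.le, hθ.2⟩
    · exact (((continuous_hankelKernel κ).comp (by fun_prop)).norm.const_mul D).intervalIntegrable
        _ _
  have a1 := hray φ hφ0
  have a2 := hray (-φ) (by rw [abs_neg, hφ0])
  unfold hankelIntegral
  refine (norm_add_le _ _).trans ?_
  rw [norm_smul, Complex.norm_I, one_mul, mul_add, mul_add]
  gcongr
  exact (norm_sub_le _ _).trans (add_le_add a1 a2)

theorem hankelIntegral_smul_const [CompleteSpace E] (φ x : ℝ) (f : ℂ → ℂ) (v : E) :
    hankelIntegral φ x (fun w => f w • v) = hankelIntegral φ x f • v := by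
  unfold hankelIntegral
  rw [integral_smul_const, integral_smul_const, intervalIntegral.integral_smul_const,
    add_smul, sub_smul, smul_assoc]

theorem hasSum_hankelIntegral [CompleteSpace E] {φ : ℝ} (h1 : Real.pi / 2 < φ)
    (h2 : φ < Real.pi) {κ x : ℝ} {F : ℕ → ℂ → E} {f : ℂ → E} {c : ℕ → ℝ} (hc : Summable c)
    (hF : ∀ k, Continuous (F k))
    (hFc : ∀ k w, x ≤ w.re → ‖F k w‖ ≤ c k * ‖hankelKernel κ w‖)
    (hFf : ∀ w : ℂ, x ≤ w.re → HasSum (fun k => F k w) (f w)) :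
    HasSum (fun k => hankelIntegral φ x (F k)) (hankelIntegral φ x f) := by
  have hpi := Real.pi_pos
  have hφ : Real.cos φ < 0 := Real.cos_neg_of_pi_div_two_lt_of_lt h1 (by linarith)
  have hray : ∀ s : ℝ, Real.cos s < 0 →
      HasSum (fun k => ∫ u in Set.Ioi x, F k (u + s * Complex.I))
        (∫ u in Set.Ioi x, f (u + s * Complex.I)) := fun s hs => by
    refine hasSum_integral_of_dominated_convergence
      (fun k u => c k * ‖hankelKernel κ (u + s * Complex.I)‖)
      (fun k => ((hF k).comp (by fun_prop)).aestronglyMeasurable) (fun k => ?_)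
      (ae_of_all _ fun u => hc.mul_right _) ?_ ?_
    · filter_upwards [ae_restrict_mem measurableSet_Ioi] with u hu
      exact hFc k _ (by simpa using le_of_lt hu)
    · simp_rw [tsum_mul_right]
      exact (integrableOn_hankelKernel hs x).norm.const_mul _
    · filter_upwards [ae_restrict_mem measurableSet_Ioi] with u hu
      exact hFf _ (by simpa using le_of_lt hu)
  have harc : HasSum (fun k => ∫ θ in (-φ)..φ, F k (x + θ * Complex.I))
      (∫ θ in (-φ)..φ, f (x + θ * Complex.I)) := by
    refine intervalIntegral.hasSum_integral_of_dominated_convergence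
      (fun k θ => c k * ‖hankelKernel κ (x + θ * Complex.I)‖)
      (fun k => ((hF k).comp (by fun_prop)).aestronglyMeasurable)
      (fun k => ae_of_all _ fun θ _ => hFc k _ (by simp))
      (ae_of_all _ fun θ _ => hc.mul_right _) ?_ (ae_of_all _ fun θ _ => hFf _ (by simp))
    simp_rw [tsum_mul_right]
    exact (((continuous_hankelKernel κ).comp (by fun_prop)).norm.const_mul _).intervalIntegrable
      _ _
  exact ((hray φ hφ).sub (hray (-φ) (by rwa [Real.cos_neg]))).add (harc.const_smul Complex.I)

end

/-! ### Resolvent bounds and decay in a complex Banach algebra -/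

section Resolvent

variable {B : Type*} [NormedRing B] [NormedAlgebra ℂ B] [CompleteSpace B]

theorem hasSum_resolvent {a : B} {z : ℂ} (hz : z ≠ 0) (h : ‖z⁻¹ • a‖ < 1) :
    HasSum (fun k : ℕ => z⁻¹ ^ (k + 1) • a ^ k) (resolvent a z) := by
  have hs := (summable_geometric_of_norm_lt_one h).hasSum
  have h1 : resolvent a z = z⁻¹ • ∑' k : ℕ, (z⁻¹ • a) ^ k := by
    set T := ∑' k : ℕ, (z⁻¹ • a) ^ k
    have e : algebraMap ℂ B z - a = z • (1 - z⁻¹ • a) := by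
      rw [smul_sub, smul_inv_smul₀ hz, Algebra.algebraMap_eq_smul_one]
    have e1 : (algebraMap ℂ B z - a) * (z⁻¹ • T) = 1 := by
      rw [e, smul_mul_smul_comm, mul_neg_geom_series _ h, mul_inv_cancel₀ hz, one_smul]
    have e2 : (z⁻¹ • T) * (algebraMap ℂ B z - a) = 1 := by
      rw [e, smul_mul_smul_comm, geom_series_mul_neg _ h, inv_mul_cancel₀ hz, one_smul]
    exact Ring.inverse_unit (⟨_, _, e1, e2⟩ : Bˣ)
  rw [h1]
  refine (hs.const_smul z⁻¹).congr_fun ?_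
  intro k
  rw [smul_pow, smul_smul, pow_succ']

theorem resolvent_smul {B : Type*} [Ring B] [Algebra ℂ B] {r : ℂ} (hr : r ≠ 0) (a : B) (z : ℂ) :
    resolvent (r • a) z = r⁻¹ • resolvent a (r⁻¹ * z) := by
  have := spectrum.units_smul_resolvent (r := (Units.mk0 r hr)⁻¹) (s := r⁻¹ * z) (a := a)
  simp only [Units.smul_def, inv_inv, Units.val_inv_eq_inv_val, Units.val_mk0, smul_eq_mul] at this
  rw [this, mul_inv_cancel_left₀ hr]

theorem mem_resolventSet_smul {B : Type*} [Ring B] [Algebra ℂ B] {r : ℂ} (hr : r ≠ 0) {a : B} {z : ℂ}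
    (h : r⁻¹ * z ∈ resolventSet ℂ a) : z ∈ resolventSet ℂ (r • a) := by
  rw [spectrum.mem_resolventSet_iff] at h ⊢
  have e : algebraMap ℂ B z - r • a = (Units.mk0 r hr) • (algebraMap ℂ B (r⁻¹ * z) - a) := by
    rw [Units.smul_def, Units.val_mk0, smul_sub, Algebra.algebraMap_eq_smul_one,
      Algebra.algebraMap_eq_smul_one, smul_smul, mul_inv_cancel_left₀ hr]
  rw [e]
  exact h.smul _

/-- A closed sector around the positive real axis which avoids the spectrum and whose preimage
under `z ↦ z ^ α` is wider than a half-plane, together with a bound for the resolvent on it. -/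
theorem exists_sector_resolvent_bound {α : ℝ} (hα0 : 0 < α) (hα1 : α < 1) {a : B}
    (ha : spectrum ℂ a ⊆ {z : ℂ | z ≠ 0 ∧ α * Real.pi / 2 < |z.arg|}) :
    ∃ φ : ℝ, Real.pi / 2 < φ ∧ φ < Real.pi ∧ ∃ C : ℝ, ∀ w : ℂ, |w.im| ≤ φ →
      Complex.exp (α * w) ∈ resolventSet ℂ a ∧ ‖resolvent a (Complex.exp (α * w))‖ ≤ C := by
  have hpi := Real.pi_pos
  -- The inequality expresses that `z` is nonzero and `|arg z| > α φ`. It holds at `φ = π / 2` and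
  -- is open in `(φ, z)`, so compactness of the spectrum yields one `φ` slightly larger than `π /
  -- 2`.
  have hev : ∀ᶠ φ in 𝓝 (Real.pi / 2), ∀ z ∈ spectrum ℂ a, z.re < ‖z‖ * Real.cos (α * φ) := by
    refine (spectrum.isCompact a).eventually_forall_of_forall_eventually fun z hz => ?_
    have hcont : Continuous fun p : ℝ × ℂ => ‖p.2‖ * Real.cos (α * p.1) - p.2.re := by fun_prop
    obtain ⟨hz0, hz1⟩ := ha hz
    have hlt : 0 < ‖z‖ * Real.cos (α * (Real.pi / 2)) - z.re := by
      rw [← Complex.norm_mul_cos_arg z, ← Real.cos_abs z.arg, ← mul_sub]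
      refine mul_pos (norm_pos_iff.2 hz0) (sub_pos.2 ?_)
      exact Real.cos_lt_cos_of_nonneg_of_le_pi (by positivity) (Complex.abs_arg_le_pi z)
        (by linarith)
    filter_upwards [hcont.continuousAt.eventually (lt_mem_nhds hlt)] with p hp
    exact sub_pos.1 hp
  obtain ⟨φ, hφ, hφ1, hφ2⟩ := ((hev.filter_mono nhdsWithin_le_nhds).and
    (Ioo_mem_nhdsGT (show Real.pi / 2 < Real.pi by linarith))).exists
  set F : Set ℂ := {z | ‖z‖ * Real.cos (α * φ) ≤ z.re} with hF
  have hFc : IsClosed F := isClosed_le (by fun_prop) (by fun_prop)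
  have hFr : ∀ z ∈ F, z ∈ resolventSet ℂ a := fun z hz => by
    by_contra h
    exact absurd (hφ z h) (not_lt.2 hz)
  have hcont : ContinuousOn (resolvent a) F := fun z hz =>
    (spectrum.hasDerivAt_resolvent_const_left (hFr z hz)).continuousAt.continuousWithinAt
  -- The sector is unbounded: the resolvent tends to zero at infinity, and compactness handles the
  -- rest.
  have hfar : ∀ᶠ z in Bornology.cobounded ℂ, ‖resolvent a z‖ < 1 := by
    have := (spectrum.resolvent_tendsto_cobounded a (𝕜 := ℂ)).norm
    rw [norm_zero] at this
    exact this.eventually (gt_mem_nhds one_pos)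
  obtain ⟨R, -, hR⟩ := (hasBasis_cobounded_norm.eventually_iff).1 hfar
  obtain ⟨C, hC⟩ := ((isCompact_closedBall (0 : ℂ) R).inter_left hFc).exists_bound_of_continuousOn
    (hcont.mono Set.inter_subset_left)
  refine ⟨φ, hφ1, hφ2, max C 1, fun w hw => ?_⟩
  have hwF : Complex.exp (α * w) ∈ F := by
    have h1 : |α * w.im| ≤ α * φ := by
      rw [abs_mul, abs_of_pos hα0]
      gcongr
    have h2 : α * φ ≤ Real.pi := by nlinarith
    rw [hF, Set.mem_ofPred_eq, Complex.norm_exp, Complex.exp_re]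
    gcongr
    rw [← Real.cos_abs (α * w : ℂ).im]
    have e : (α * w : ℂ).im = α * w.im := by simp
    rw [e]
    exact Real.cos_le_cos_of_nonneg_of_le_pi (abs_nonneg _) h2 h1
  refine ⟨hFr _ hwF, ?_⟩
  rcases le_total ‖Complex.exp (α * w)‖ R with h | h
  · exact (hC _ ⟨hwF, by simpa using h⟩).trans (le_max_left _ _)
  · exact (hR h).le.trans (le_max_right _ _)

theorem hankelKernel_sub_mul (α κ : ℝ) (k : ℕ) (w : ℂ) :
    hankelKernel (κ - α * (k + 1)) w =
      hankelKernel κ w * (Complex.exp (α * w))⁻¹ ^ (k + 1) := by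
  rw [hankelKernel, hankelKernel, ← Complex.exp_neg, ← Complex.exp_nat_mul, ← Complex.exp_add]
  push_cast
  ring_nf

/-- On the contour `‖exp (α w)‖ ≥ exp (α x) > ‖M‖`, so the resolvent expands in a Neumann series.
Its `k`-th term turns the kernel exponent into `1 - (α k + β)`, and Hankel's formula returns `1 /
Γ(α k + β)`. -/
theorem hankelIntegral_resolvent {φ : ℝ} (h1 : Real.pi / 2 < φ) (h2 : φ < Real.pi)
    {α : ℝ} (hα0 : 0 < α) (β : ℝ) {M S : B} {x : ℝ} (hx : ‖M‖ < Real.exp (α * x))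
    (hS : HasSum (fun k : ℕ => (((Real.Gamma (α * k + β))⁻¹ : ℝ) : ℂ) • M ^ k) S) :
    hankelIntegral φ x
      (fun w => hankelKernel (1 + α - β) w • resolvent M (Complex.exp (α * w))) =
      (2 * Real.pi * Complex.I : ℂ) • S := by
  have hexp : ∀ w : ℂ, x ≤ w.re → ‖(Complex.exp (α * w))⁻¹‖ ≤ Real.exp (-(α * x)) := fun w hw => by
    rw [← Complex.exp_neg, Complex.norm_exp]
    have : α * x ≤ α * w.re := by gcongr
    simpa using this
  have hlt : Real.exp (-(α * x)) * ‖M‖ < 1 := by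
    rw [Real.exp_neg, inv_mul_lt_iff₀ (Real.exp_pos _), mul_one]
    exact hx
  have hc : Summable fun k : ℕ => Real.exp (-(α * x)) ^ (k + 1) * ‖M ^ k‖ := by
    have h := summable_norm_geometric_of_norm_lt_one
      (r := ((Real.exp (-(α * x)) : ℝ) : ℂ) • M) (by
        rwa [norm_smul, Complex.norm_real, Real.norm_of_nonneg (Real.exp_pos _).le])
    refine (h.mul_left (Real.exp (-(α * x)))).congr fun k => ?_
    rw [smul_pow, norm_smul, norm_pow, Complex.norm_real,
      Real.norm_of_nonneg (Real.exp_pos _).le, pow_succ']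
    ring
  have h := hasSum_hankelIntegral (x := x) (κ := 1 + α - β) h1 h2
    (F := fun k w => hankelKernel (1 - (α * k + β)) w • M ^ k)
    (f := fun w => hankelKernel (1 + α - β) w • resolvent M (Complex.exp (α * w))) hc
    (fun k => (continuous_hankelKernel _).smul continuous_const) ?_ ?_
  · refine h.unique ((hS.const_smul (2 * Real.pi * Complex.I : ℂ)).congr_fun ?_)
    intro k
    rw [hankelIntegral_smul_const, hankelIntegral_eq h1 h2.le, smul_smul]
  · intro k w hw
    rw [show 1 - (α * k + β) = 1 + α - β - α * (k + 1) by ring, hankelKernel_sub_mul, norm_smul,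
      norm_mul, norm_pow]
    have := pow_le_pow_left₀ (norm_nonneg _) (hexp w hw) (k + 1)
    calc _ = ‖(Complex.exp (α * w))⁻¹‖ ^ (k + 1) *
          (‖M ^ k‖ * ‖hankelKernel (1 + α - β) w‖) := by ring
      _ ≤ Real.exp (-(α * x)) ^ (k + 1) * (‖M ^ k‖ * ‖hankelKernel (1 + α - β) w‖) := by gcongr
      _ = _ := by ring
  · intro w hw
    refine ((hasSum_resolvent (Complex.exp_ne_zero (α * w)) ?_).const_smul
      (hankelKernel (1 + α - β) w)).congr_fun ?_
    · rw [norm_smul]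
      exact (mul_le_mul_of_nonneg_right (hexp w hw) (norm_nonneg _)).trans_lt hlt
    · intro k
      rw [show 1 - (α * k + β) = 1 + α - β - α * (k + 1) by ring, hankelKernel_sub_mul, smul_smul]

/-- Decay of Mittag-Leffler functions along an element whose spectrum avoids a sector. -/
theorem exists_norm_mittagLeffler_le {α : ℝ} (hα0 : 0 < α) (hα1 : α < 1) {a : B}
    (ha : spectrum ℂ a ⊆ {z : ℂ | z ≠ 0 ∧ α * Real.pi / 2 < |z.arg|}) (β : ℝ) :
    ∃ C : ℝ, ∀ t : ℝ, 0 < t → ∀ S : B,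
      HasSum (fun k : ℕ => (((Real.Gamma (α * k + β))⁻¹ : ℝ) : ℂ) •
        (((t ^ α : ℝ) : ℂ) • a) ^ k) S → ‖S‖ ≤ C * t ^ (-α) := by
  have hpi := Real.pi_pos
  obtain ⟨φ, h1, h2, C, hC⟩ := exists_sector_resolvent_bound hα0 hα1 ha
  obtain ⟨K, hK⟩ := exists_norm_hankelIntegral_le (E := B) h1 h2 (1 + α - β)
  refine ⟨C * K / (2 * Real.pi), fun t ht S hS => ?_⟩
  have hφ : Real.cos φ < 0 := Real.cos_neg_of_pi_div_two_lt_of_lt h1 (by linarith)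
  have hφ0 : |φ| = φ := abs_of_pos (by linarith)
  set r : ℂ := ((t ^ α : ℝ) : ℂ) with hr
  have hta : 0 < t ^ α := Real.rpow_pos_of_pos ht α
  have hr0 : r ≠ 0 := Complex.ofReal_ne_zero.2 hta.ne'
  -- Dividing by `t ^ α` is translation of `w` by `-log t`, which preserves the strip; the sector
  -- bound is therefore uniform in `t`.
  have hscale : ∀ w : ℂ, r⁻¹ * Complex.exp (α * w) =
      Complex.exp (α * (w - (Real.log t : ℝ))) := fun w => by
    rw [hr, Real.rpow_def_of_pos ht, Complex.ofReal_exp, ← Complex.exp_neg, ← Complex.exp_add]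
    push_cast
    ring_nf
  have him : ∀ w : ℂ, (w - (Real.log t : ℝ)).im = w.im := fun w => by simp
  have hmem : ∀ w : ℂ, |w.im| ≤ φ → Complex.exp (α * w) ∈ resolventSet ℂ (r • a) := fun w hw =>
    mem_resolventSet_smul hr0 (by rw [hscale]; exact (hC _ (by rwa [him])).1)
  have hbd : ∀ w : ℂ, |w.im| ≤ φ →
      ‖resolvent (r • a) (Complex.exp (α * w))‖ ≤ t ^ (-α) * C := fun w hw => by
    rw [resolvent_smul hr0, hscale, norm_smul, norm_inv, hr, Complex.norm_real,
      Real.norm_of_nonneg hta.le, Real.rpow_neg ht.le]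
    gcongr
    exact (hC _ (by rwa [him])).2
  set f : ℂ → B := fun w =>
    hankelKernel (1 + α - β) w • resolvent (r • a) (Complex.exp (α * w)) with hf
  have hfd : ∀ w : ℂ, |w.im| ≤ φ → DifferentiableAt ℂ f w := fun w hw => by
    have e1 := (spectrum.hasDerivAt_resolvent_const_left (hmem w hw)).differentiableAt
    exact (differentiable_hankelKernel _ w).smul
      (e1.comp w (f := fun w => Complex.exp (α * w)) (by fun_prop))
  have hfb : ∀ w : ℂ, |w.im| ≤ φ → ‖f w‖ ≤ t ^ (-α) * C * ‖hankelKernel (1 + α - β) w‖ :=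
    fun w hw => by
      rw [hf, norm_smul, mul_comm]
      exact mul_le_mul_of_nonneg_right (hbd w hw) (norm_nonneg _)
  have hint : ∀ s : ℝ, |s| = φ → ∀ x : ℝ,
      IntegrableOn (fun u : ℝ => f (u + s * Complex.I)) (Set.Ioi x) := fun s hs x => by
    have him' : ∀ u : ℝ, |((u : ℂ) + s * Complex.I).im| ≤ φ := fun u => by simp [hs]
    refine integrableOn_ray_of_norm_le (by rwa [← Real.cos_abs, hs])
      (continuous_iff_continuousAt.2 fun u => ?_) (fun u _ => hfb _ (him' u))
    exact (hfd _ (him' u)).continuousAt.comp (f := fun u : ℝ => (u : ℂ) + s * Complex.I)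
      (by fun_prop)
  -- The series representation requires `x` large depending on `t`; holomorphy on the strip then
  -- moves the contour back to `0`.
  obtain ⟨x, hx⟩ : ∃ x : ℝ, ‖r • a‖ < Real.exp (α * x) :=
    ((Real.tendsto_exp_atTop.comp (tendsto_id.const_mul_atTop hα0)).eventually_gt_atTop _).exists
  have hU := hankelIntegral_resolvent h1 h2 hα0 β hx hS
  rw [hankelIntegral_eq_of_differentiable (y := 0) (by linarith) hfd (hint φ hφ0)
    (hint (-φ) (by rw [abs_neg, hφ0]))] at hU
  have h := hK f _ hfb
  rw [hU, norm_smul] at h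
  have hn : ‖(2 * Real.pi * Complex.I : ℂ)‖ = 2 * Real.pi := by
    simp [abs_of_pos hpi]
  rw [hn] at h
  rw [div_mul_eq_mul_div, le_div_iff₀ (by positivity)]
  linarith

end Resolvent
end

/-! ### Transfer to real matrices -/

section MatrixMittagLeffler

attribute [local instance] Matrix.linftyOpNormedRing Matrix.linftyOpNormedAlgebra

variable {d : ℕ}

theorem linfty_opNorm_map_algebraMap (M : Matrix (Fin d) (Fin d) ℝ) :
    ‖M.map (algebraMap ℝ ℂ)‖ = ‖M‖ := by
  simp [Matrix.linfty_opNorm_def]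

theorem exists_linfty_opNorm_mittagLeffler₂_le {α : ℝ} (hα0 : 0 < α) (hα1 : α < 1)
    {A : Matrix (Fin d) (Fin d) ℝ}
    (hA : spectrum ℂ (A.map (algebraMap ℝ ℂ)) ⊆ {z : ℂ | z ≠ 0 ∧ α * Real.pi / 2 < |z.arg|})
    (β : ℝ) :
    ∃ C : ℝ, ∀ t : ℝ, 0 < t → ‖mittagLeffler₂ α β (t ^ α • A)‖ ≤ C * t ^ (-α) := by
  have : CompleteSpace (Matrix (Fin d) (Fin d) ℂ) := FiniteDimensional.complete ℂ _
  obtain ⟨C, hC⟩ := exists_norm_mittagLeffler_le hα0 hα1 hA β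
  refine ⟨C, fun t ht => ?_⟩
  rw [← linfty_opNorm_map_algebraMap]
  refine hC t ht _ ?_
  have hcont : Continuous ((algebraMap ℝ ℂ).mapMatrix (m := Fin d)) := by
    exact continuous_id.matrix_map Complex.continuous_ofReal
  have h := (summable_mittagLeffler₂ hα0 β (t ^ α • A)).hasSum.map
    (algebraMap ℝ ℂ).mapMatrix hcont
  refine h.congr_fun fun k => ?_
  ext i j
  simp only [Function.comp, RingHom.mapMatrix_apply, Matrix.map_apply, smul_pow, Matrix.smul_apply]
  have e : (A.map (algebraMap ℝ ℂ)) ^ k = (A ^ k).map (algebraMap ℝ ℂ) :=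
    (map_pow (algebraMap ℝ ℂ).mapMatrix A k).symm
  rw [e]
  simp

/-- The constant term drops out because `(Real.Gamma 0)⁻¹ = 0`; the remaining series is shifted by
one index. -/
theorem mittagLeffler₂_zero_eq_mul {α : ℝ} (hα : 0 < α) (M : Matrix (Fin d) (Fin d) ℝ) :
    mittagLeffler₂ α 0 M = M * mittagLeffler₂ α α M := by
  unfold mittagLeffler₂
  rw [(summable_mittagLeffler₂ hα 0 M).tsum_eq_zero_add,
    ← (summable_mittagLeffler₂ hα α M).tsum_mul_left]
  simp [pow_succ', mul_add]

/-- One factor `t ^ (-α)` comes from the decay for `β = 0`, the other from inverting `t ^ α • A`. -/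
theorem exists_linfty_opNorm_mittagLeffler₂_self_le {α : ℝ} (hα0 : 0 < α) (hα1 : α < 1)
    {A : Matrix (Fin d) (Fin d) ℝ}
    (hA : spectrum ℂ (A.map (algebraMap ℝ ℂ)) ⊆ {z : ℂ | z ≠ 0 ∧ α * Real.pi / 2 < |z.arg|}) :
    ∃ C : ℝ, ∀ t : ℝ, 0 < t → ‖mittagLeffler₂ α α (t ^ α • A)‖ ≤ C * t ^ (-(2 * α)) := by
  obtain ⟨C, hC⟩ := exists_linfty_opNorm_mittagLeffler₂_le hα0 hα1 hA 0
  have hdet : IsUnit A.det := by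
    have h0 : IsUnit (A.map (algebraMap ℝ ℂ)) :=
      (spectrum.zero_notMem_iff ℂ).1 fun h => (hA h).1 rfl
    rw [Matrix.isUnit_iff_isUnit_det, ← RingHom.mapMatrix_apply, ← RingHom.map_det,
      isUnit_iff_ne_zero, map_ne_zero] at h0
    exact h0.isUnit
  refine ⟨‖A⁻¹‖ * C, fun t ht => ?_⟩
  have hta : 0 < t ^ α := Real.rpow_pos_of_pos ht α
  have e : mittagLeffler₂ α α (t ^ α • A) =
      t ^ (-α) • (A⁻¹ * mittagLeffler₂ α 0 (t ^ α • A)) := by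
    rw [mittagLeffler₂_zero_eq_mul hα0, Matrix.smul_mul, Matrix.mul_smul,
      Matrix.nonsing_inv_mul_cancel_left _ _ hdet, smul_smul, ← Real.rpow_add ht]
    simp
  rw [e, norm_smul, Real.norm_of_nonneg (Real.rpow_nonneg ht.le _)]
  calc t ^ (-α) * ‖A⁻¹ * mittagLeffler₂ α 0 (t ^ α • A)‖
      ≤ t ^ (-α) * (‖A⁻¹‖ * (C * t ^ (-α))) := by
        gcongr
        exact (norm_mul_le _ _).trans (by gcongr; exact hC t ht)
    _ = ‖A⁻¹‖ * C * t ^ (-(2 * α)) := by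
        rw [show -(2 * α) = -α + -α by ring, Real.rpow_add ht]
        ring

theorem exists_linfty_opNorm_mittagLeffler₂_le_of_le_one {α : ℝ} (hα0 : 0 < α) (β : ℝ)
    (A : Matrix (Fin d) (Fin d) ℝ) :
    ∃ C : ℝ, ∀ t : ℝ, 0 < t → t ≤ 1 → ‖mittagLeffler₂ α β (t ^ α • A)‖ ≤ C := by
  have hs := summable_norm_iff.2 (summable_mittagLeffler₂ hα0 β A)
  refine ⟨∑' k : ℕ, ‖(Real.Gamma (α * k + β))⁻¹ • A ^ k‖, fun t ht ht1 => ?_⟩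
  refine tsum_of_norm_bounded hs.hasSum fun k => ?_
  have h1 : (t ^ α) ^ k ≤ 1 := pow_le_one₀ (by positivity) (Real.rpow_le_one ht.le ht1 hα0.le)
  rw [smul_pow, smul_comm, norm_smul, Real.norm_of_nonneg (by positivity)]
  exact mul_le_of_le_one_left (norm_nonneg _) h1

theorem aestronglyMeasurable_mittagLeffler₂ {α : ℝ} (hα0 : 0 < α) (β : ℝ)
    (A : Matrix (Fin d) (Fin d) ℝ) (μ : Measure ℝ) :
    AEStronglyMeasurable (fun t : ℝ => mittagLeffler₂ α β (t ^ α • A)) μ := by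
  have : TopologicalSpace.PseudoMetrizableSpace (Matrix (Fin d) (Fin d) ℝ) :=
    inferInstanceAs (TopologicalSpace.PseudoMetrizableSpace (Fin d → Fin d → ℝ))
  refine aestronglyMeasurable_of_tendsto_ae atTop
    (f := fun (n : ℕ) (t : ℝ) =>
      ∑ k ∈ Finset.range n, (Real.Gamma (α * k + β))⁻¹ • (t ^ α • A) ^ k) (fun n => ?_)
    (ae_of_all _ fun t => (summable_mittagLeffler₂ hα0 β (t ^ α • A)).hasSum.tendsto_sum_nat)
  have : Continuous fun t : ℝ => t ^ α := Real.continuous_rpow_const hα0.le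
  exact (continuous_finsetSum _ fun k _ => by fun_prop).aestronglyMeasurable

/-- A seminorm is convex, hence continuous in finite dimension, hence bounded by a multiple of the
norm. -/
theorem Seminorm.exists_le_linfty_opNorm (N : Seminorm ℝ (Matrix (Fin d) (Fin d) ℝ)) :
    Continuous N ∧ ∃ K : ℝ, 0 ≤ K ∧ ∀ M, N M ≤ K * ‖M‖ := by
  have hN : Continuous N := continuousOn_univ.1 (N.convexOn.continuousOn isOpen_univ)
  obtain ⟨K, hK, h⟩ := N.bound_of_continuous_normedSpace hN
  exact ⟨hN, K, hK.le, h⟩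

end MatrixMittagLeffler

theorem lemma5 {d : ℕ} (α : ℝ) (hα0 : 0 < α) (hα1 : α < 1)
    (A : Matrix (Fin d) (Fin d) ℝ)
    (hA : spectrum ℂ (A.map (algebraMap ℝ ℂ)) ⊆
      {z : ℂ | z ≠ 0 ∧ α * Real.pi / 2 < |z.arg|})
    (N : Seminorm ℝ (Matrix (Fin d) (Fin d) ℝ)) (hN : ∀ M, N M = 0 → M = 0) :
    Tendsto (fun t : ℝ => N (mittagLeffler α (t ^ α • A))) atTop (𝓝 0) ∧
    IntegrableOn (fun τ : ℝ => τ ^ (α - 1) * N (mittagLeffler₂ α α (τ ^ α • A)))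
      (Set.Ioi 0) := by
  obtain ⟨hNc, K, hK0, hK⟩ := N.exists_le_linfty_opNorm
  constructor
  · obtain ⟨C, hC⟩ := exists_linfty_opNorm_mittagLeffler₂_le hα0 hα1 hA 1
    refine squeeze_zero' (g := fun t : ℝ => K * (C * t ^ (-α)))
      (Eventually.of_forall fun t => apply_nonneg N _) ?_ ?_
    · filter_upwards [eventually_gt_atTop 0] with t ht
      exact (hK _).trans (mul_le_mul_of_nonneg_left (hC t ht) hK0)
    · simpa using ((tendsto_rpow_neg_atTop hα0).const_mul C).const_mul K
  · obtain ⟨C, hC⟩ := exists_linfty_opNorm_mittagLeffler₂_self_le hα0 hα1 hA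
    obtain ⟨D, hD⟩ := exists_linfty_opNorm_mittagLeffler₂_le_of_le_one hα0 α A
    have hmeas : ∀ s : Set ℝ, AEStronglyMeasurable
        (fun τ : ℝ => τ ^ (α - 1) * N (mittagLeffler₂ α α (τ ^ α • A))) (volume.restrict s) :=
      fun s => (by fun_prop : Measurable fun τ : ℝ => τ ^ (α - 1)).aestronglyMeasurable.mul
        (hNc.comp_aestronglyMeasurable (aestronglyMeasurable_mittagLeffler₂ hα0 α A _))
    -- Up to `1` the Mittag-Leffler factor is bounded and `τ ^ (α - 1)` is integrable; beyond `1`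
    -- the exponents combine to `(α - 1) - 2α = -1 - α < -1`.
    rw [← Set.Ioc_union_Ioi_eq_Ioi zero_le_one]
    refine IntegrableOn.union ?_ ?_
    · have hi : IntegrableOn (fun τ : ℝ => τ ^ (α - 1) * (K * D)) (Set.Ioc 0 1) :=
        ((intervalIntegrable_iff_integrableOn_Ioc_of_le zero_le_one).1
          (intervalIntegral.intervalIntegrable_rpow' (by linarith))).mul_const _
      refine Integrable.mono' hi (hmeas _) ?_
      filter_upwards [ae_restrict_mem measurableSet_Ioc] with τ hτ
      have h0 : 0 ≤ τ ^ (α - 1) := Real.rpow_nonneg hτ.1.le _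
      rw [Real.norm_of_nonneg (mul_nonneg h0 (apply_nonneg N _))]
      exact mul_le_mul_of_nonneg_left
        ((hK _).trans (mul_le_mul_of_nonneg_left (hD τ hτ.1 hτ.2) hK0)) h0
    · have hi : IntegrableOn (fun τ : ℝ => τ ^ (-1 - α) * (K * C)) (Set.Ioi 1) :=
        (integrableOn_Ioi_rpow_of_lt (by linarith) one_pos).mul_const _
      refine Integrable.mono' hi (hmeas _) ?_
      filter_upwards [ae_restrict_mem measurableSet_Ioi] with τ hτ
      have hτ0 : 0 < τ := zero_lt_one.trans hτ
      have h0 : 0 ≤ τ ^ (α - 1) := Real.rpow_nonneg hτ0.le _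
      rw [Real.norm_of_nonneg (mul_nonneg h0 (apply_nonneg N _))]
      calc τ ^ (α - 1) * N (mittagLeffler₂ α α (τ ^ α • A))
          ≤ τ ^ (α - 1) * (K * (C * τ ^ (-(2 * α)))) :=
            mul_le_mul_of_nonneg_left
              ((hK _).trans (mul_le_mul_of_nonneg_left (hC τ hτ0) hK0)) h0
        _ = τ ^ (-1 - α) * (K * C) := by
            rw [show -1 - α = (α - 1) + -(2 * α) by ring, Real.rpow_add hτ0]
            ring
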